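/- Let $\mathfrak X\subseteq\mathcal P(\mathbb N)$ and fix a standard pairing function $\langle\cdot,\cdot\rangle$ on $\mathbb N$. Let $\mathbb N_{\mathfrak X}=\langle\mathbb N,A\rangle_{A\in\mathfrak X}$ be the standard model in the language $\mathcal L_{\mathfrak X}$ of arithmetic expanded by a unary predicate for each $A\in\mathfrak X$. $\mathfrak X$ is a *Scott set* if it is a Boolean algebra of sets, is closed under relative Turing computability, and contains a set coding a path through every infinite binary tree coded by a set in $\mathfrak X$; it is *arithmetically closed* if every subset of $\mathbb N$ definable in $\mathbb N_{\mathfrak X}$ belongs to $\mathfrak X$. $\mathfrak X/\mathrm{Fin}$ is the poset of infinite sets in $\mathfrak X$ ordered by almost inclusion ($A\le B$ iff $A\setminus B$ is finite). $\mathfrak X$ is a *proper Scott set* if it is an arithmetically closed Scott set and $\mathfrak X/\mathrm{Fin}$ is a proper forcing notion. A set $B\in\mathfrak X$ codes the sequence of sets $B_n=\{m\mid\langle n,m\rangle\in B\}$; a condition $C\in\mathfrak X/\mathrm{Fin}$ *decides* this sequence if $\{n\mid B_n\in U\}\in\mathfrak X$ for every ultrafilter $U$ on the Boolean algebra $\mathfrak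 X$ with $C\in U$. Let $\mathscr D_B$ be the set of conditions deciding $\langle B_n\mid n\in\mathbb N\rangle$. A function $f:\mathbb N\to\mathbb N$ is *coded in* $\mathfrak X$ if $\{\langle n,f(n)\rangle\mid n\in\mathbb N\}\in\mathfrak X$. For an ultrafilter $G$ on an arithmetically closed $\mathfrak X$, the ultrapower $\Pi_{\mathfrak X}\mathbb N/G$ is the $\mathcal L_{\mathfrak X}$-structure of all classes $[f]_G$ of functions coded in $\mathfrak X$, where $f\sim_G g$ iff $\{n\mid f(n)=g(n)\}\in G$, operations are pointwise, and a relation holds iff it holds pointwise on a set in $G$ (so $A$ is interpreted by $A'=\{[f]_G\mid\{n\mid f(n)\in A\}\in G\}$). An elementary extension $M\prec N$ is *conservative* if it is a proper extension and for every parametrically definable $D\subseteq N$ the set $D\cap M$ is parametrically definable in $M$. **Theorem.** Assume the Proper Forcing Axiom (for every proper poset $\mathbb P$ and every collection of at most $\omega_1$ dense subsets of $\mathbb P$ there is a filter on $\mathbb P$ meeting all of them). Let $\mathfrak X$ be a proper Scott set of size $\omega_1$. Then $\langle\mathbb N,A\rangle_{A\in\mathfrak X}$ has a conservative elementary extension.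 More precisely, there is an ultrafilter $G$ on $\mathfrak X$, all of whose members are infinite, such that for each of the (at most $\omega_1$ many) sequences $\langle B_n\mid n\in\mathbb N\rangle$ coded by a set $B\in\mathfrak X$ the set $\mathscr D_B$ is dense in $\mathfrak X/\mathrm{Fin}$ and $G\cap\mathscr D_B\neq\emptyset$, and such that the map $n\mapsto[c_n]_G$, where $c_n$ is the constant function with value $n$, is an elementary embedding that makes $\langle\Pi_{\mathfrak X}\mathbb N/G,A'\rangle_{A\in\mathfrak X}$ a conservative elementary extension of $\langle\mathbb N,A\rangle_{A\in\mathfrak X}$. -/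

import Mathlib

open Cardinal FirstOrder FirstOrder.Language

universe u

namespace Forcing

/-! ### Forcing notions, properness and the Proper Forcing Axiom

As usual in forcing, a "poset" is a nonempty preordered set; `p ≤ q` means that `p` is stronger. -/

/-- `D` is dense: every condition has an extension in `D`. -/
def IsDense {P : Type u} [Preorder P] (D : Set P) : Prop :=
  ∀ p : P, ∃ d ∈ D, d ≤ p

/-- Two conditions are compatible when they have a common extension. -/
def Compatible {P : Type u} [Preorder P] (p q : P) : Prop :=
  ∃ r : P, r ≤ p ∧ r ≤ q

/-- A maximal antichain: its elements are pairwise incompatible, and every condition is compatible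
with one of them. -/
def IsMaxAntichain {P : Type u} [Preorder P] (A : Set P) : Prop :=
  (∀ a ∈ A, ∀ b ∈ A, a ≠ b → ¬ Compatible a b) ∧ ∀ p : P, ∃ a ∈ A, Compatible a p

/-- The relation symbol of the language of set theory. -/
inductive SetRel : ℕ → Type
  | mem : SetRel 2

/-- The language of set theory, with one binary relation symbol. -/
def setLang : FirstOrder.Language.{0, 0} := ⟨fun _ => Empty, SetRel⟩

/-- `H_κ`: the sets whose transitive closure has size less than `κ`. The transitive closure of `x`
consists of all `y` with a finite chain `y ∈ ⋯ ∈ x`. -/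
def Hered (κ : Cardinal.{u}) : Set ZFSet.{u} :=
  {x | #{y : ZFSet.{u} // Relation.TransGen (· ∈ ·) y x} < Cardinal.lift.{u + 1} κ}

instance heredStructure (κ : Cardinal.{u}) : setLang.Structure (Hered κ) where
  funMap := fun f => f.elim
  RelMap := fun r => match r with
    | SetRel.mem => fun v => (v 0 : ZFSet.{u}) ∈ (v 1 : ZFSet.{u})

/-- The set `x` is an element of the elementary submodel `M` of `H_κ`. -/
def InModel {κ : Cardinal.{u}} (M : setLang.ElementarySubstructure (Hered κ)) (x : ZFSet.{u}) :
    Prop :=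
  ∃ h : x ∈ Hered κ, (⟨x, h⟩ : Hered κ) ∈ M

/-- The subset `A` of `P`, as a set, when the conditions of `P` are identified with sets by `e`. -/
noncomputable def codeSet {P : Type u} (e : P ↪ ZFSet.{u}) (A : Set P) : ZFSet.{u} :=
  ZFSet.range fun a : A => e a

/-- The isomorphic copy of the forcing notion `P` in the universe of sets that is given by the
injection `e`: the ordered pair of the set of conditions and the ordering. -/
noncomputable def codePoset {P : Type u} [Preorder P] (e : P ↪ ZFSet.{u}) : ZFSet.{u} :=
  ZFSet.pair (codeSet e Set.univ)
    (ZFSet.range fun z : {z : P × P // z.1 ≤ z.2} => ZFSet.pair (e z.1.1) (e z.1.2))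

/-- `q` is an `M`-generic condition: for every maximal antichain `A ∈ M`, the condition `q` forces
that the generic filter meets `A ∩ M`, that is, `A ∩ M` is predense below `q`. -/
def IsGenericCondition {P : Type u} [Preorder P] (e : P ↪ ZFSet.{u}) {κ : Cardinal.{u}}
    (M : setLang.ElementarySubstructure (Hered κ)) (q : P) : Prop :=
  ∀ A : Set P, IsMaxAntichain A → InModel M (codeSet e A) →
    ∀ r ≤ q, ∃ a ∈ A, InModel M (e a) ∧ Compatible a r

/-- Properness of a forcing notion `P`: for (every isomorphic copy of `P` among the sets and) every
cardinal `κ > 2 ^ |P|`, every countable `M ≺ H_κ` containing `P` and every condition `p ∈ M` there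
is an `M`-generic condition below `p`. -/
def IsProper (P : Type u) [Preorder P] : Prop :=
  ∀ (e : P ↪ ZFSet.{u}) (κ : Cardinal.{u}), 2 ^ #P < κ →
    ∀ M : setLang.ElementarySubstructure (Hered κ), Countable M → InModel M (codePoset e) →
      ∀ p : P, InModel M (e p) → ∃ q ≤ p, IsGenericCondition e M q

/-- The Proper Forcing Axiom: for every proper forcing notion `P` and every collection of at most
`ℵ₁` dense subsets of `P` there is a filter on `P` that meets all of them. -/
def ProperForcingAxiom : Prop :=
  ∀ (P : Type u) [Preorder P] [Nonempty P], IsProper P →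
    ∀ 𝒟 : Set (Set P), #𝒟 ≤ ℵ₁ → (∀ D ∈ 𝒟, IsDense D) →
      ∃ F : Order.PFilter P, ∀ D ∈ 𝒟, ∃ p ∈ F, p ∈ D

end Forcing

namespace Scott

/-! ### The structure `⟨ℕ, A⟩_{A ∈ X}` -/

/-- The function symbols of arithmetic. -/
inductive ArithFunc : ℕ → Type
  | zero : ArithFunc 0
  | one : ArithFunc 0
  | add : ArithFunc 2
  | mul : ArithFunc 2

/-- The order symbol of arithmetic and a unary predicate symbol for every `A ∈ X`. -/
inductive ArithRel (X : Set (Set ℕ)) : ℕ → Type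
  | lt : ArithRel X 2
  | pred (A : X) : ArithRel X 1

/-- The language of arithmetic expanded by unary predicates for the members of `X`. -/
def arithLang (X : Set (Set ℕ)) : FirstOrder.Language.{0, 0} := ⟨ArithFunc, ArithRel X⟩

-- The symbols, as symbols of the language `arithLang X`.

def zeroSym (X : Set (Set ℕ)) : (arithLang X).Functions 0 := ArithFunc.zero
def oneSym (X : Set (Set ℕ)) : (arithLang X).Functions 0 := ArithFunc.one
def addSym (X : Set (Set ℕ)) : (arithLang X).Functions 2 := ArithFunc.add
def mulSym (X : Set (Set ℕ)) : (arithLang X).Functions 2 := ArithFunc.mul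
def ltSym (X : Set (Set ℕ)) : (arithLang X).Relations 2 := ArithRel.lt
def predSym {X : Set (Set ℕ)} (A : X) : (arithLang X).Relations 1 := ArithRel.pred A

/-- The structure `⟨ℕ, A⟩_{A ∈ X}`. -/
instance natStructure (X : Set (Set ℕ)) : (arithLang X).Structure ℕ where
  funMap := fun f => match f with
    | ArithFunc.zero => fun _ => 0
    | ArithFunc.one => fun _ => 1
    | ArithFunc.add => fun v => v 0 + v 1
    | ArithFunc.mul => fun v => v 0 * v 1
  RelMap := fun r => match r with
    | ArithRel.lt => fun v => v 0 < v 1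
    | ArithRel.pred A => fun v => v 0 ∈ (A : Set ℕ)

/-! ### Scott sets -/

open Classical in
/-- The characteristic function of `A`. -/
noncomputable def charFun (A : Set ℕ) : ℕ →. ℕ :=
  fun n => Part.some (if n ∈ A then 1 else 0)

/-- A Scott set. Finite binary sequences are coded by numbers through the standard computable
coding of lists; a path through a tree is given by the set of those `n` at which it takes the
value `1`. -/
structure IsScottSet (X : Set (Set ℕ)) : Prop where
  empty_mem : ∅ ∈ X
  compl_mem : ∀ A ∈ X, Aᶜ ∈ X
  union_mem : ∀ A ∈ X, ∀ B ∈ X, A ∪ B ∈ X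
  computable_mem : ∀ A ∈ X, ∀ B : Set ℕ, TuringReducible (charFun B) (charFun A) → B ∈ X
  path_mem : ∀ T : Set (List Bool), T.Infinite → (∀ s t : List Bool, s <+: t → t ∈ T → s ∈ T) →
    Encodable.encode '' T ∈ X →
      ∃ P : ℕ → Bool, (∀ n, (List.range n).map P ∈ T) ∧ {n | P n = true} ∈ X

/-- `X` is arithmetically closed: every subset of `ℕ` definable in `⟨ℕ, A⟩_{A ∈ X}` is in `X`. -/
def ArithClosed (X : Set (Set ℕ)) : Prop :=
  ∀ B : Set ℕ, (∅ : Set ℕ).Definable₁ (arithLang X) B → B ∈ X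

/-- The conditions of the forcing notion `X/Fin`: the infinite members of `X`. -/
structure ModFin (X : Set (Set ℕ)) where
  carrier : Set ℕ
  mem : carrier ∈ X
  infinite : carrier.Infinite

/-- The ordering of `X/Fin` is almost inclusion. -/
instance (X : Set (Set ℕ)) : Preorder (ModFin X) where
  le A B := (A.carrier \ B.carrier).Finite
  le_refl A := by simp
  le_trans A B C hAB hBC := (hAB.union hBC).subset fun n hn => by
    by_cases h : n ∈ B.carrier
    · exact Or.inr ⟨h, hn.2⟩
    · exact Or.inl ⟨hn.1, h⟩

/-- A proper Scott set: an arithmetically closed Scott set `X` such that `X/Fin` is proper. -/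
structure IsProperScottSet (X : Set (Set ℕ)) : Prop where
  isScottSet : IsScottSet X
  arithClosed : ArithClosed X
  isProper : Forcing.IsProper (ModFin X)

/-! ### Ultrafilters on `X` -/

/-- An ultrafilter on the Boolean algebra of sets `X`. -/
structure UltrafilterOn (X : Set (Set ℕ)) where
  sets : Set (Set ℕ)
  sub : sets ⊆ X
  univ_mem : Set.univ ∈ sets
  empty_notMem : ∅ ∉ sets
  inter_mem : ∀ A ∈ sets, ∀ B ∈ sets, A ∩ B ∈ sets
  mem_of_superset : ∀ A ∈ sets, ∀ B ∈ X, A ⊆ B → B ∈ sets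
  mem_or_compl_mem : ∀ A ∈ X, A ∈ sets ∨ Aᶜ ∈ sets

/-- `G` consists of infinite sets. -/
def UltrafilterOn.Nonprincipal {X : Set (Set ℕ)} (G : UltrafilterOn X) : Prop :=
  ∀ A ∈ G.sets, A.Infinite

/-- The `n`-th set `B_n = {m | ⟨n, m⟩ ∈ B}` of the sequence coded by `B`. -/
def slice (B : Set ℕ) (n : ℕ) : Set ℕ := {m | Nat.pair n m ∈ B}

/-- `C ∈ X/Fin` decides the sequence `⟨B_n⟩` coded by `B`: whenever `U` is an ultrafilter on `X`
with `C ∈ U`, then `{n | B_n ∈ U} ∈ X`. -/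
def Decides {X : Set (Set ℕ)} (C : ModFin X) (B : Set ℕ) : Prop :=
  ∀ U : UltrafilterOn X, C.carrier ∈ U.sets → {n | slice B n ∈ U.sets} ∈ X

/-- The set of all conditions in `X/Fin` that decide the sequence coded by `B`. -/
def decidingSet (X : Set (Set ℕ)) (B : Set ℕ) : Set (ModFin X) := {C | Decides C B}

/-! ### Functions coded in `X` -/

/-- The function `f` is coded in `X`: its graph is (via the pairing function) in `X`. -/
def IsCoded (X : Set (Set ℕ)) (f : ℕ → ℕ) : Prop :=
  {k | ∃ n, k = Nat.pair n (f n)} ∈ X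

/-- The formula `k = ⟨a, b⟩`. -/
def pairFormula (X : Set (Set ℕ)) {α : Type} (k a b : (arithLang X).Term α) :
    (arithLang X).Formula α :=
  ((ltSym X).formula₂ a b ⊓
      Term.equal k ((addSym X).apply₂ ((mulSym X).apply₂ b b) a)) ⊔
    (∼((ltSym X).formula₂ a b) ⊓
      Term.equal k ((addSym X).apply₂ ((addSym X).apply₂ ((mulSym X).apply₂ a a) a) b))

theorem realize_pairFormula (X : Set (Set ℕ)) {α : Type} (k a b : (arithLang X).Term α)
    (v : α → ℕ) :
    (pairFormula X k a b).Realize v ↔ k.realize v = Nat.pair (a.realize v) (b.realize v) := by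
  have hlt : ∀ x y : ℕ, Structure.RelMap (ltSym X) ![x, y] ↔ x < y := fun _ _ => Iff.rfl
  have hadd : ∀ x y : ℕ, Structure.funMap (addSym X) ![x, y] = x + y := fun _ _ => rfl
  have hmul : ∀ x y : ℕ, Structure.funMap (mulSym X) ![x, y] = x * y := fun _ _ => rfl
  simp only [pairFormula, Formula.realize_sup, Formula.realize_inf, Formula.realize_not,
    Formula.realize_rel₂, Formula.realize_equal, Term.realize_functions_apply₂, hlt, hadd, hmul,
    Nat.pair]
  split_ifs with h <;> simp [h]

/-- The formula `f a = b`, for a function `f` whose graph is coded by `A ∈ X`. -/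
noncomputable def graphFormula (X : Set (Set ℕ)) (A : X) {α : Type} (a b : α) :
    (arithLang X).Formula α :=
  Formula.iExs (L := arithLang X) Unit
    (pairFormula X (Term.var (Sum.inr ())) (Term.var (Sum.inl a)) (Term.var (Sum.inl b)) ⊓
      (predSym A).formula₁ (Term.var (Sum.inr ())))

theorem realize_graphFormula {X : Set (Set ℕ)} {f : ℕ → ℕ} (hf : IsCoded X f) {α : Type}
    (a b : α) (v : α → ℕ) : (graphFormula X ⟨_, hf⟩ a b).Realize v ↔ f (v a) = v b := by
  have hp : ∀ (A : X) (x : ℕ), Structure.RelMap (predSym A) ![x] ↔ x ∈ (A : Set ℕ) := fun _ _ => Iff.rfl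
  simp only [graphFormula, Formula.realize_iExs, Formula.realize_inf, realize_pairFormula,
    Formula.realize_rel₁, hp, Term.realize_var, Sum.elim_inl, Sum.elim_inr, Set.mem_ofPred_eq]
  constructor
  · rintro ⟨i, h1, n, h2⟩
    rw [h1, Nat.pair_eq_pair] at h2
    rw [h2.1, h2.2]
  · intro h
    exact ⟨fun _ => Nat.pair (v a) (v b), rfl, v a, by rw [h]⟩

/-- For an arithmetically closed `X`, a relation definable in `⟨ℕ, A⟩_{A ∈ X}` pulls back along
coded functions to a member of `X`. -/
theorem ArithClosed.setOf_realize_mem {X : Set (Set ℕ)} (hX : ArithClosed X) {ι : Type} [Finite ι]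
    (φ : (arithLang X).Formula ι) (f : ι → ℕ → ℕ) (hf : ∀ i, IsCoded X (f i)) :
    {n | φ.Realize fun i => f i n} ∈ X := by
  apply hX
  rw [Set.Definable₁, Set.empty_definable_iff]
  refine ⟨Formula.iExs (L := arithLang X) ι (φ.relabel Sum.inr ⊓
    Formula.iInf fun i => graphFormula X ⟨_, hf i⟩ (Sum.inl (0 : Fin 1)) (Sum.inr i)), ?_⟩
  ext v
  simp only [Set.mem_ofPred_eq, Formula.realize_iExs, Formula.realize_inf, Formula.realize_relabel,
    Formula.realize_iInf, realize_graphFormula, Sum.elim_inl, Sum.elim_inr, Sum.elim_comp_inr]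
  constructor
  · intro h
    exact ⟨fun i => f i (v 0), h, fun i => rfl⟩
  · rintro ⟨w, hw, h⟩
    have : w = fun i => f i (v 0) := funext fun i => (h i).symm
    rwa [this] at hw

theorem ArithClosed.eq_mem {X : Set (Set ℕ)} (hX : ArithClosed X) {f g : ℕ → ℕ}
    (hf : IsCoded X f) (hg : IsCoded X g) : {n | f n = g n} ∈ X := by
  have := hX.setOf_realize_mem
    (Term.equal (Term.var 0) (Term.var 1) : (arithLang X).Formula (Fin 2)) ![f, g]
    (by intro i; fin_cases i <;> assumption)
  simpa using this

theorem ArithClosed.relMap_mem {X : Set (Set ℕ)} (hX : ArithClosed X) {k : ℕ}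
    (r : (arithLang X).Relations k) (f : Fin k → ℕ → ℕ) (hf : ∀ i, IsCoded X (f i)) :
    {n | Structure.RelMap r fun i => f i n} ∈ X := by
  simpa [Formula.realize_rel] using
    hX.setOf_realize_mem (r.formula fun i => Term.var i) f hf

/-- For an arithmetically closed `X`, the coded functions are closed under the operations of
arithmetic. -/
theorem ArithClosed.isCoded_funMap {X : Set (Set ℕ)} (hX : ArithClosed X) {k : ℕ}
    (F : (arithLang X).Functions k) (f : Fin k → ℕ → ℕ) (hf : ∀ i, IsCoded X (f i)) :
    IsCoded X fun n => Structure.funMap F fun i => f i n := by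
  apply hX
  rw [Set.Definable₁, Set.empty_definable_iff]
  refine ⟨Formula.iExs (L := arithLang X) (Option (Fin k))
    (pairFormula X (Term.var (Sum.inl (0 : Fin 1))) (Term.var (Sum.inr none))
        (Term.func F fun i => Term.var (Sum.inr (some i))) ⊓
      Formula.iInf fun i => graphFormula X ⟨_, hf i⟩ (Sum.inr none) (Sum.inr (some i))), ?_⟩
  ext v
  simp only [Set.mem_ofPred_eq, Formula.realize_iExs, Formula.realize_inf, realize_pairFormula,
    Formula.realize_iInf, realize_graphFormula, Sum.elim_inl, Sum.elim_inr, Term.realize_var,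
    Term.realize_func]
  constructor
  · rintro ⟨n, hn⟩
    exact ⟨fun o => o.elim n fun i => f i n, hn, fun i => rfl⟩
  · rintro ⟨w, hw, h⟩
    refine ⟨w none, ?_⟩
    rw [hw]
    simp only [h]

theorem ArithClosed.isCoded_const {X : Set (Set ℕ)} (hX : ArithClosed X) (c : ℕ) :
    IsCoded X fun _ => c := by
  induction c with
  | zero => exact hX.isCoded_funMap (zeroSym X) (fun _ _ => 0) fun i => i.elim0
  | succ c ih =>
    have h1 : IsCoded X fun _ => 1 :=
      hX.isCoded_funMap (oneSym X) (fun _ _ => 0) fun i => i.elim0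
    refine hX.isCoded_funMap (addSym X) ![fun _ => c, fun _ => 1] ?_
    intro i
    fin_cases i
    · exact ih
    · exact h1

/-- The type of functions `ℕ → ℕ` coded in `X`. -/
def CodedFun (X : Set (Set ℕ)) : Type := {f : ℕ → ℕ // IsCoded X f}

/-! ### The ultrapower `Π_X ℕ / G` -/

/-- `f ∼_G g` iff `{n | f n = g n} ∈ G`. -/
def ultraSetoid {X : Set (Set ℕ)} (hX : ArithClosed X) (G : UltrafilterOn X) :
    Setoid (CodedFun X) where
  r f g := {n | f.1 n = g.1 n} ∈ G.sets
  iseqv :=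
    { refl := fun f => by simpa using G.univ_mem
      symm := fun {f g} h => by simpa only [eq_comm] using h
      trans := fun {f g h} h1 h2 =>
        G.mem_of_superset _ (G.inter_mem _ h1 _ h2) _ (hX.eq_mem f.2 h.2)
          fun n hn => Eq.trans hn.1 hn.2 }

theorem UltrafilterOn.iInter_mem {X : Set (Set ℕ)} (G : UltrafilterOn X) :
    ∀ {k : ℕ} (A : Fin k → Set ℕ), (∀ i, A i ∈ G.sets) → {n | ∀ i, n ∈ A i} ∈ G.sets
  | 0, A, _ => by simpa using G.univ_mem
  | k + 1, A, h => by
    have := G.inter_mem _ (h 0) _ (G.iInter_mem (fun i : Fin k => A i.succ) fun i => h i.succ)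
    simp only [Fin.forall_fin_succ]
    exact this

/-- The operations on coded functions are pointwise, and a relation holds of coded functions iff it
holds pointwise on a set in `G`; both respect `∼_G`. -/
instance ultraPrestructure {X : Set (Set ℕ)} (hX : ArithClosed X) (G : UltrafilterOn X) :
    (arithLang X).Prestructure (ultraSetoid hX G) where
  toStructure :=
    { funMap := fun F f => ⟨fun n => Structure.funMap F fun i => (f i).1 n,
        hX.isCoded_funMap F _ fun i => (f i).2⟩
      RelMap := fun r f => {n | Structure.RelMap r fun i => (f i).1 n} ∈ G.sets }
  fun_equiv := fun {k F} f g h =>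
    G.mem_of_superset _ (G.iInter_mem _ h) _
      (hX.eq_mem (hX.isCoded_funMap F _ fun i => (f i).2) (hX.isCoded_funMap F _ fun i => (g i).2))
      fun n hn => congrArg (Structure.funMap F) (funext hn)
  rel_equiv := fun {k r} f g h => by
    have key : ∀ f g : Fin k → CodedFun X, (∀ i, {n | (f i).1 n = (g i).1 n} ∈ G.sets) →
        {n | Structure.RelMap r fun i => (f i).1 n} ∈ G.sets →
        {n | Structure.RelMap r fun i => (g i).1 n} ∈ G.sets := by
      intro f g h hf
      refine G.mem_of_superset _ (G.inter_mem _ (G.iInter_mem _ h) _ hf) _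
        (hX.relMap_mem r _ fun i => (g i).2) ?_
      rintro n ⟨hn, hr⟩
      have : (fun i => (f i).1 n) = fun i => (g i).1 n := funext hn
      simpa only [Set.mem_ofPred_eq, this] using hr
    exact propext ⟨key f g h, key g f fun i => (ultraSetoid hX G).symm (h i)⟩

/-- The ultrapower `Π_X ℕ / G`: the coded functions modulo `∼_G`. -/
def Ultrapower {X : Set (Set ℕ)} (hX : ArithClosed X) (G : UltrafilterOn X) : Type :=
  Quotient (ultraSetoid hX G)

/-- The ultrapower as a structure in the language expanded by predicates for all `A ∈ X`. -/
instance {X : Set (Set ℕ)} (hX : ArithClosed X) (G : UltrafilterOn X) :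
    (arithLang X).Structure (Ultrapower hX G) :=
  inferInstanceAs ((arithLang X).Structure (Quotient (ultraSetoid hX G)))

/-- The class `[f]_G`. -/
def Ultrapower.mk {X : Set (Set ℕ)} (hX : ArithClosed X) (G : UltrafilterOn X) (f : CodedFun X) :
    Ultrapower hX G :=
  Quotient.mk (ultraSetoid hX G) f

/-! ### Conservative extensions -/

/-- The elementary extension `j : M → N` is conservative: it is a proper extension, and the
restriction to `M` of every parametrically definable subset of `N` is parametrically definable
in `M`. -/
def IsConservative {L : FirstOrder.Language.{0, 0}} {M N : Type} [L.Structure M] [L.Structure N]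
    (j : M ↪ₑ[L] N) : Prop :=
  ¬ Function.Surjective j ∧
    ∀ D : Set N, (Set.univ : Set N).Definable₁ L D → (Set.univ : Set M).Definable₁ L (j ⁻¹' D)

end Scott

/-!
For `B ∈ X`, compare natural numbers `m` through the sequences `(m ∈ B_n)_n`, ordered
lexicographically. The Ramsey argument with peaks and records arithmetically thins any infinite set
to an infinite set `C` along which these sequences are monotone. Then, for every `n`, their first
`n` entries are eventually constant along `C`, so each `B_n` contains almost all or almost none of
`C`. A nonprincipal ultrafilter `U ∋ C` therefore satisfies `B_n ∈ U ↔ C \ B_n` is finite, which is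
an arithmetical condition on `n`.

A filter on `X/Fin` that meets these dense sets, one for each `B ∈ X`, generates an ultrafilter `G`
for which all the sets `{n | B_n ∈ G}` are in `X`. Least-witness Skolem functions are coded because
`X` is arithmetically closed, so Łoś's theorem holds. By Łoś, the trace on `ℕ` of a parametrically
definable subset of the ultrapower has the form `{n | B_n ∈ G}` with `B ∈ X`.
-/

namespace Forcing

/-- The forcing axiom `FA_κ(P)`: for every collection of at most `κ` dense subsets of `P` there is
a filter on `P` that meets all of them. -/
def ForcingAxiom (P : Type u) [Preorder P] (κ : Cardinal.{u}) : Prop :=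
  ∀ 𝒟 : Set (Set P), #𝒟 ≤ κ → (∀ D ∈ 𝒟, IsDense D) →
    ∃ F : Order.PFilter P, ∀ D ∈ 𝒟, ∃ p ∈ F, p ∈ D

end Forcing

namespace Scott

section Definability

variable {L : FirstOrder.Language} {M : Type*} [L.Structure M] {A : Set M} {α β : Type*}

theorem definable_not {p : (α → M) → Prop} (hp : A.Definable L {v | p v}) :
    A.Definable L {v | ¬ p v} :=
  hp.compl

theorem definable_and {p q : (α → M) → Prop} (hp : A.Definable L {v | p v})
    (hq : A.Definable L {v | q v}) : A.Definable L {v | p v ∧ q v} :=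
  hp.inter hq

theorem definable_or {p q : (α → M) → Prop} (hp : A.Definable L {v | p v})
    (hq : A.Definable L {v | q v}) : A.Definable L {v | p v ∨ q v} :=
  hp.union hq

theorem definable_imp {p q : (α → M) → Prop} (hp : A.Definable L {v | p v})
    (hq : A.Definable L {v | q v}) : A.Definable L {v | p v → q v} := by
  simpa only [imp_iff_not_or] using definable_or (definable_not hp) hq

theorem definable_iff {p q : (α → M) → Prop} (hp : A.Definable L {v | p v})
    (hq : A.Definable L {v | q v}) : A.Definable L {v | p v ↔ q v} := by
  simpa only [iff_iff_implies_and_implies] using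
    definable_and (definable_imp hp hq) (definable_imp hq hp)

theorem definable_exists {p : (α → M) → M → Prop}
    (hp : A.Definable L {w : Option α → M | p (fun a => w (some a)) (w none)}) :
    A.Definable L {v | ∃ a, p v a} := by
  have h := (hp.preimage_comp (Equiv.optionEquivSumPUnit.{0} α)).exists_of_finite
  convert! h using 1
  ext v
  exact ⟨fun ⟨a, ha⟩ => ⟨fun _ => a, ha⟩, fun ⟨u, hu⟩ => ⟨u default, hu⟩⟩

theorem definable_forall {p : (α → M) → M → Prop}
    (hp : A.Definable L {w : Option α → M | p (fun a => w (some a)) (w none)}) :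
    A.Definable L {v | ∀ a, p v a} := by
  simpa only [not_exists_not] using
    definable_not (definable_exists (p := fun v a => ¬ p v a) (definable_not hp))

theorem definable_comp₂ {R : M → M → Prop} (hR : A.Definable L {v : Fin 2 → M | R (v 0) (v 1)})
    {t s : (α → M) → M} (ht : A.DefinableFun L t) (hs : A.DefinableFun L s) :
    A.Definable L {v | R (t v) (s v)} := by
  have hts : A.DefinableMap L fun v => ![t v, s v] := by simp [Set.DefinableMap, *]
  exact hR.preimage_map hts

theorem definable_realize (φ : L.Formula β) [Finite β] {t : β → (α → M) → M}
    (ht : ∀ i, A.DefinableFun L (t i)) : A.Definable L {v | φ.Realize fun i => t i v} := by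
  have hφ : A.Definable L {v : β → M | φ.Realize v} :=
    (Set.empty_definable_iff.2 ⟨φ, rfl⟩).mono (Set.empty_subset A)
  exact hφ.preimage_map (F := fun v i => t i v) ht

theorem definable_boundedRealize {n : ℕ} (φ : L.BoundedFormula β n) [Finite β]
    {t : β → (α → M) → M} (ht : ∀ i, A.DefinableFun L (t i))
    {s : Fin n → (α → M) → M} (hs : ∀ i, A.DefinableFun L (s i)) :
    A.Definable L {v | φ.Realize (fun i => t i v) fun i => s i v} := by
  have h := definable_realize φ.toFormula (t := Sum.elim t s) (Sum.forall.2 ⟨ht, hs⟩)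
  simpa only [BoundedFormula.realize_toFormula, Function.comp_def, Sum.elim_inl,
    Sum.elim_inr] using h

theorem definable_boundedRealize_snoc {n : ℕ} (φ : L.BoundedFormula β (n + 1)) [Finite β]
    {t : β → (α → M) → M} (ht : ∀ i, A.DefinableFun L (t i))
    {s : Fin n → (α → M) → M} (hs : ∀ i, A.DefinableFun L (s i))
    {u : (α → M) → M} (hu : A.DefinableFun L u) :
    A.Definable L
      {v | φ.Realize (fun i => t i v) (Fin.snoc (fun i => s i v) (u v) : Fin (n + 1) → M)} := by
  have hsu : ∀ i, A.DefinableFun L ((Fin.snoc s u : Fin (n + 1) → (α → M) → M) i) :=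
    Fin.forall_fin_succ'.2 ⟨by simpa using hs, by simpa using hu⟩
  have hsnoc (v : α → M) : (fun i => (Fin.snoc s u : Fin (n + 1) → (α → M) → M) i v) =
      Fin.snoc (fun i => s i v) (u v) :=
    Fin.comp_snoc (fun h : (α → M) → M => h v) s u
  simpa only [hsnoc] using definable_boundedRealize φ ht hsu

end Definability

section Arithmetic

variable {X : Set (Set ℕ)} {P : Set ℕ} {α : Type*} {t s : (α → ℕ) → ℕ}

theorem definable_lt (ht : P.DefinableFun (arithLang X) t) (hs : P.DefinableFun (arithLang X) s) :
    P.Definable (arithLang X) {v | t v < s v} :=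
  definable_realize ((ltSym X).formula Term.var) (t := ![t, s]) (by simp [*])

theorem definable_mem {A : Set ℕ} (hA : A ∈ X) (ht : P.DefinableFun (arithLang X) t) :
    P.Definable (arithLang X) {v | t v ∈ A} :=
  definable_realize ((predSym ⟨A, hA⟩).formula Term.var) (t := fun _ => t) fun _ => ht

theorem definableFun_const (c : ℕ) : P.DefinableFun (arithLang X) fun _ : α → ℕ => c := by
  induction c with
  | zero => exact .of_empty (Constants.term (zeroSym X)).definableFun_realize
  | succ c ih =>
    have hone : P.DefinableFun (arithLang X) fun _ : α → ℕ => 1 :=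
      .of_empty (Constants.term (oneSym X)).definableFun_realize
    exact (Set.DefinableFun.of_empty (.fun_symbol (addSym X))).comp (g := fun _ => ![c, 1])
      (by simp [Set.DefinableMap, *])

theorem definableFun_pair (ht : P.DefinableFun (arithLang X) t)
    (hs : P.DefinableFun (arithLang X) s) :
    P.DefinableFun (arithLang X) fun v => Nat.pair (t v) (s v) := by
  have hpair : P.DefinableFun (arithLang X) fun v : Fin 2 → ℕ => Nat.pair (v 0) (v 1) := by
    refine .of_empty (Set.empty_definableFun_iff.2
      ⟨pairFormula X (.var none) (.var (some 0)) (.var (some 1)), ?_⟩)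
    ext v
    simpa [Function.tupleGraph, realize_pairFormula] using eq_comm
  exact hpair.comp (g := fun v => ![t v, s v]) (by simp [Set.DefinableMap, *])

theorem definable_mem_slice {B : Set ℕ} (hB : B ∈ X) (ht : P.DefinableFun (arithLang X) t)
    (hs : P.DefinableFun (arithLang X) s) : P.Definable (arithLang X) {v | s v ∈ slice B (t v)} :=
  definable_mem hB (definableFun_pair ht hs)

theorem IsCoded.definableFun {f : ℕ → ℕ} (hf : IsCoded X f)
    (ht : P.DefinableFun (arithLang X) t) : P.DefinableFun (arithLang X) fun v => f (t v) := by
  have hgraph : P.DefinableFun (arithLang X) fun v : Fin 1 → ℕ => f (v 0) := by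
    refine .of_empty (Set.empty_definableFun_iff.2
      ⟨graphFormula X ⟨_, hf⟩ (some 0) none, ?_⟩)
    ext v
    simp [Function.tupleGraph, realize_graphFormula]
  exact hgraph.comp (g := fun v _ => t v) fun _ => ht

namespace ArithClosed

variable {A B : Set ℕ}

theorem mem_of_definable (hX : ArithClosed X) {p : ℕ → Prop}
    (hp : (∅ : Set ℕ).Definable (arithLang X) {v : Fin 1 → ℕ | p (v 0)}) : {n | p n} ∈ X :=
  hX _ hp

theorem univ_mem (hX : ArithClosed X) : Set.univ ∈ X :=
  hX _ Set.definable_univ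

theorem compl_mem (hX : ArithClosed X) (hA : A ∈ X) : Aᶜ ∈ X :=
  hX.mem_of_definable (definable_not (definable_mem hA (.proj _)))

theorem inter_mem (hX : ArithClosed X) (hA : A ∈ X) (hB : B ∈ X) : A ∩ B ∈ X :=
  hX.mem_of_definable (definable_and (definable_mem hA (.proj _)) (definable_mem hB (.proj _)))

theorem image_pair_mem (hX : ArithClosed X) {R : ℕ → ℕ → Prop}
    (hR : (∅ : Set ℕ).Definable (arithLang X) {v : Fin 2 → ℕ | R (v 0) (v 1)}) :
    {k | ∃ n m, k = Nat.pair n m ∧ R n m} ∈ X :=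
  hX.mem_of_definable <| definable_exists <| definable_exists <| definable_and
    ((Set.DefinableFun.proj _).ofPred_eq (definableFun_pair (.proj _) (.proj _)))
    (definable_comp₂ hR (.proj _) (.proj _))

theorem exists_slice_eq (hX : ArithClosed X) {R : ℕ → ℕ → Prop}
    (hR : (∅ : Set ℕ).Definable (arithLang X) {v : Fin 2 → ℕ | R (v 0) (v 1)}) :
    ∃ B ∈ X, ∀ n, slice B n = {m | R n m} := by
  refine ⟨_, hX.image_pair_mem hR, fun n => ?_⟩
  ext m
  simp [slice, Nat.pair_eq_pair]

theorem singleton_mem (hX : ArithClosed X) (k : ℕ) : {k} ∈ X :=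
  hX.mem_of_definable ((Set.DefinableFun.proj _).ofPred_eq (definableFun_const k))

theorem setOf_gt_mem (hX : ArithClosed X) (k : ℕ) : {m | k < m} ∈ X :=
  hX.mem_of_definable (definable_lt (definableFun_const k) (.proj _))

theorem slice_mem (hX : ArithClosed X) (hB : B ∈ X) (n : ℕ) : slice B n ∈ X :=
  hX.mem_of_definable (definable_mem_slice hB (definableFun_const n) (.proj _))

theorem setOf_mem_slice_mem (hX : ArithClosed X) (hB : B ∈ X) (k : ℕ) : {n | k ∈ slice B n} ∈ X :=
  hX.mem_of_definable (definable_mem_slice hB (.proj _) (definableFun_const k))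

theorem isCoded_of_definable_graph (hX : ArithClosed X) {f : ℕ → ℕ}
    (hf : (∅ : Set ℕ).Definable (arithLang X) {v : Fin 2 → ℕ | f (v 0) = v 1}) : IsCoded X f := by
  simpa only [IsCoded, exists_eq_right'] using hX.image_pair_mem (R := fun n m => f n = m) hf

theorem isCoded_find (hX : ArithClosed X) {R : ℕ → ℕ → Prop} [∀ k, DecidablePred (R k)]
    (hR : (∅ : Set ℕ).Definable (arithLang X) {v : Fin 2 → ℕ | R (v 0) (v 1)})
    (h : ∀ k, ∃ a, R k a) : IsCoded X fun k => Nat.find (h k) := by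
  refine hX.isCoded_of_definable_graph ?_
  simp only [Nat.find_eq_iff]
  exact definable_and hR <| definable_forall <| definable_imp (definable_lt (.proj _) (.proj _)) <|
    definable_not <| definable_comp₂ hR (.proj _) (.proj _)

theorem exists_isCoded_skolem (hX : ArithClosed X) {R : ℕ → ℕ → Prop}
    (hR : (∅ : Set ℕ).Definable (arithLang X) {v : Fin 2 → ℕ | R (v 0) (v 1)}) :
    ∃ c : ℕ → ℕ, IsCoded X c ∧ ∀ k, (∃ a, R k a) → R k (c k) := by
  classical
  have htotal (k : ℕ) : ∃ a, (∃ b, R k b) → R k a :=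
    ⟨Classical.epsilon (R k), Classical.epsilon_spec⟩
  have hdef : (∅ : Set ℕ).Definable (arithLang X)
      {v : Fin 2 → ℕ | (∃ b, R (v 0) b) → R (v 0) (v 1)} :=
    definable_imp (definable_exists (definable_comp₂ hR (.proj _) (.proj _))) hR
  exact ⟨_, hX.isCoded_find hdef htotal, fun k => Nat.find_spec (htotal k)⟩

end ArithClosed

end Arithmetic

section Monotone

variable {R : Type*} [LinearOrder R] {x : ℕ → R} {C E : Set ℕ}

/-- The peaks of the sequence `x` along `C`: the `m ∈ C` at which `x` is at least as large as at
all later members of `C`. -/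
def peaks (x : ℕ → R) (C : Set ℕ) : Set ℕ := {m | m ∈ C ∧ ∀ k, k ∈ C → m < k → x k ≤ x m}

/-- The records of the sequence `x` along `C`: the `m ∈ C` at which `x` is larger than at all
earlier members of `C`. -/
def records (x : ℕ → R) (C : Set ℕ) : Set ℕ := {m | m ∈ C ∧ ∀ k, k ∈ C → k < m → x k < x m}

theorem antitoneOn_peaks (x : ℕ → R) (C : Set ℕ) : AntitoneOn x (peaks x C) := by
  intro m hm k hk hmk
  obtain rfl | hlt := hmk.eq_or_lt
  exacts [le_rfl, hm.2 k hk.1 hlt]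

theorem monotoneOn_records (x : ℕ → R) (C : Set ℕ) : MonotoneOn x (records x C) := by
  intro m hm k hk hmk
  obtain rfl | hlt := hmk.eq_or_lt
  exacts [le_rfl, (hk.2 m hm.1 hlt).le]

theorem exists_mem_records_gt (hC : peaks x C = ∅) {m : ℕ} (hm : m ∈ records x C) :
    ∃ k ∈ records x C, m < k := by
  classical
  have hm_peak : m ∉ peaks x C := by simp [hC]
  have hlater : ∃ k, k ∈ C ∧ m < k ∧ x m < x k := by
    simpa [peaks, hm.1] using hm_peak
  obtain ⟨hkC, hmk, hxk⟩ := Nat.find_spec hlater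
  refine ⟨Nat.find hlater, ⟨hkC, fun i hi hik => ?_⟩, hmk⟩
  obtain him | rfl | hmi := lt_trichotomy i m
  · exact (hm.2 i hi him).trans hxk
  · exact hxk
  · have hnot := Nat.find_min hlater hik
    exact (not_lt.1 fun h => hnot ⟨hi, hmi, h⟩).trans_lt hxk

theorem infinite_records (hC : peaks x C = ∅) (hne : C.Nonempty) : (records x C).Infinite := by
  refine Set.infinite_of_not_bddAbove fun hbdd => ?_
  have hmin : sInf C ∈ records x C :=
    ⟨Nat.sInf_mem hne, fun k hk hlt => absurd (Nat.sInf_le hk) hlt.not_ge⟩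
  have hmax := Nat.sSup_mem ⟨_, hmin⟩ hbdd
  obtain ⟨k, hk, hlt⟩ := exists_mem_records_gt hC hmax
  exact (le_csSup hbdd hk).not_gt hlt

theorem exists_records_infinite (hC : C.Infinite) (hpeaks : (peaks x C).Finite) :
    ∃ N, (records x (C ∩ {m | N < m})).Infinite := by
  obtain ⟨N, hN⟩ := hpeaks.bddAbove
  obtain ⟨m, hm, hNm⟩ := hC.exists_gt N
  refine ⟨N, infinite_records (Set.eq_empty_of_forall_notMem fun k hk => ?_) ⟨m, hm, hNm⟩⟩
  have hkC : k ∈ peaks x C := ⟨hk.1.1, fun i hi hki => hk.2 i ⟨hi, hk.1.2.trans hki⟩ hki⟩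
  exact (hN hkC).not_gt hk.1.2

end Monotone

section MonotoneClosed

variable {X : Set (Set ℕ)} {R : Type*} [LinearOrder R] {x : ℕ → R} {C : Set ℕ}

theorem ArithClosed.peaks_mem (hX : ArithClosed X)
    (hx : (∅ : Set ℕ).Definable (arithLang X) {v : Fin 2 → ℕ | x (v 0) < x (v 1)})
    (hC : C ∈ X) : peaks x C ∈ X := by
  refine hX.mem_of_definable <| definable_and (definable_mem hC (.proj _)) <| definable_forall <|
    definable_imp (definable_mem hC (.proj _)) <| definable_imp
      (definable_lt (.proj _) (.proj _)) ?_
  simp only [← not_lt]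
  exact definable_not (definable_comp₂ (R := fun a b => x a < x b) hx (.proj _) (.proj _))

theorem ArithClosed.records_mem (hX : ArithClosed X)
    (hx : (∅ : Set ℕ).Definable (arithLang X) {v : Fin 2 → ℕ | x (v 0) < x (v 1)})
    (hC : C ∈ X) : records x C ∈ X :=
  hX.mem_of_definable <| definable_and (definable_mem hC (.proj _)) <| definable_forall <|
    definable_imp (definable_mem hC (.proj _)) <| definable_imp
      (definable_lt (.proj _) (.proj _)) <|
      definable_comp₂ (R := fun a b => x a < x b) hx (.proj _) (.proj _)

theorem ArithClosed.exists_monotoneOn_or_antitoneOn (hX : ArithClosed X)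
    (hx : (∅ : Set ℕ).Definable (arithLang X) {v : Fin 2 → ℕ | x (v 0) < x (v 1)})
    (hC : C ∈ X) (hCinf : C.Infinite) :
    ∃ E ∈ X, E ⊆ C ∧ E.Infinite ∧ (MonotoneOn x E ∨ AntitoneOn x E) := by
  obtain hpeaks | hpeaks := (peaks x C).finite_or_infinite
  · obtain ⟨N, hN⟩ := exists_records_infinite hCinf hpeaks
    exact ⟨_, hX.records_mem hx (hX.inter_mem hC (hX.setOf_gt_mem N)), fun m hm => hm.1.1, hN,
      .inl (monotoneOn_records x _)⟩
  · exact ⟨_, hX.peaks_mem hx hC, fun m hm => hm.1, hpeaks, .inr (antitoneOn_peaks x C)⟩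

end MonotoneClosed

section Cohesive

variable {X : Set (Set ℕ)} {S : ℕ → Set ℕ} {B E : Set ℕ}

/-- `E` is cohesive for the sequence of sets `S`: each `S n` contains almost all or almost none of
the elements of `E`. -/
def IsCohesive (S : ℕ → Set ℕ) (E : Set ℕ) : Prop :=
  ∀ n, (E \ S n).Finite ∨ (E ∩ S n).Finite

theorem isCohesive_compl : IsCohesive (fun n => (S n)ᶜ) E ↔ IsCohesive S E := by
  simp only [IsCohesive, Set.sdiff_eq, compl_compl, or_comm]

/-- The characteristic sequence of `{n | m ∈ S n}`, as a point of the lexicographically ordered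
Cantor space. -/
def pattern (S : ℕ → Set ℕ) (m : ℕ) : Lex (ℕ → Prop) := toLex fun n => m ∈ S n

theorem pattern_lt_iff {a b : ℕ} : pattern S a < pattern S b ↔
    ∃ n, (∀ i, i < n → (a ∈ S i ↔ b ∈ S i)) ∧ a ∉ S n ∧ b ∈ S n :=
  exists_congr fun _ => and_congr (forall₂_congr fun _ _ => eq_iff_iff)
    ((not_le.symm.trans Classical.not_imp).trans and_comm)

theorem pattern_compl_lt_iff {a b : ℕ} :
    pattern (fun n => (S n)ᶜ) a < pattern (fun n => (S n)ᶜ) b ↔ pattern S b < pattern S a := by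
  simp only [pattern_lt_iff]
  exact exists_congr fun n => and_congr
    (forall₂_congr fun i _ => not_iff_not.trans iff_comm) (by simp [and_comm])

theorem mem_of_pattern_le {a b n : ℕ} (hab : pattern S a ≤ pattern S b)
    (hagree : ∀ i, i < n → (a ∈ S i ↔ b ∈ S i)) (ha : a ∈ S n) : b ∈ S n :=
  Pi.apply_le_of_toLex hab (fun i hi => propext (hagree i hi)) ha

theorem exists_forall_ge_agree_of_monotoneOn (hE : MonotoneOn (pattern S) E) (n : ℕ) :
    ∃ N, ∀ a ∈ E, N ≤ a → ∀ b ∈ E, N ≤ b → ∀ i, i < n → (a ∈ S i ↔ b ∈ S i) := by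
  induction n with
  | zero => exact ⟨0, by simp⟩
  | succ n ih =>
    obtain ⟨N, hN⟩ := ih
    by_cases h : ∃ c ∈ E, N ≤ c ∧ c ∈ S n
    · obtain ⟨c, hcE, hNc, hcS⟩ := h
      have hS : ∀ a ∈ E, c ≤ a → a ∈ S n := fun a ha hca =>
        mem_of_pattern_le (hE hcE ha hca) (hN c hcE hNc a ha (hNc.trans hca)) hcS
      refine ⟨c, fun a ha hca b hb hcb => Nat.forall_lt_succ_right.2 ⟨?_, ?_⟩⟩
      · exact hN a ha (hNc.trans hca) b hb (hNc.trans hcb)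
      · exact iff_of_true (hS a ha hca) (hS b hb hcb)
    · refine ⟨N, fun a ha hNa b hb hNb => Nat.forall_lt_succ_right.2 ⟨hN a ha hNa b hb hNb, ?_⟩⟩
      exact iff_of_false (fun haS => h ⟨a, ha, hNa, haS⟩) fun hbS => h ⟨b, hb, hNb, hbS⟩

theorem isCohesive_of_monotoneOn (hE : MonotoneOn (pattern S) E) : IsCohesive S E := by
  intro n
  obtain ⟨N, hN⟩ := exists_forall_ge_agree_of_monotoneOn hE (n + 1)
  by_cases h : ∃ c ∈ E, N ≤ c ∧ c ∈ S n
  · obtain ⟨c, hcE, hNc, hcS⟩ := h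
    refine .inl ((Set.finite_Iio N).subset fun a ha => Set.mem_Iio.2 (not_le.1 fun hNa => ha.2 ?_))
    exact (hN c hcE hNc a ha.1 hNa n n.lt_succ_self).1 hcS
  · exact .inr ((Set.finite_Iio N).subset fun a ha =>
      Set.mem_Iio.2 (not_le.1 fun hNa => h ⟨a, ha.1, hNa, ha.2⟩))

theorem isCohesive_of_antitoneOn (hE : AntitoneOn (pattern S) E) : IsCohesive S E :=
  isCohesive_compl.1 <| isCohesive_of_monotoneOn fun _ ha _ hb hab =>
    not_lt.1 fun hlt => (hE ha hb hab).not_gt (pattern_compl_lt_iff.1 hlt)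

theorem definable_pattern_lt (hB : B ∈ X) : (∅ : Set ℕ).Definable (arithLang X)
    {v : Fin 2 → ℕ | pattern (slice B) (v 0) < pattern (slice B) (v 1)} := by
  simp only [pattern_lt_iff]
  exact definable_exists <| definable_and
    (definable_forall <| definable_imp (definable_lt (.proj _) (.proj _)) <|
      definable_iff (definable_mem_slice hB (.proj _) (.proj _))
        (definable_mem_slice hB (.proj _) (.proj _)))
    (definable_and (definable_not (definable_mem_slice hB (.proj _) (.proj _)))
      (definable_mem_slice hB (.proj _) (.proj _)))

theorem ArithClosed.exists_isCohesive (hX : ArithClosed X) (hB : B ∈ X) {C : Set ℕ} (hC : C ∈ X)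
    (hCinf : C.Infinite) : ∃ E ∈ X, E ⊆ C ∧ E.Infinite ∧ IsCohesive (slice B) E := by
  obtain ⟨E, hE, hEC, hEinf, hmono⟩ :=
    hX.exists_monotoneOn_or_antitoneOn (definable_pattern_lt hB) hC hCinf
  exact ⟨E, hE, hEC, hEinf, hmono.elim isCohesive_of_monotoneOn isCohesive_of_antitoneOn⟩

/-- The set of all conditions in `X/Fin` that are cohesive for the sequence coded by `B`. -/
def cohesiveSet (X : Set (Set ℕ)) (B : Set ℕ) : Set (ModFin X) :=
  {C | IsCohesive (slice B) C.carrier}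

theorem ArithClosed.isDense_cohesiveSet (hX : ArithClosed X) (hB : B ∈ X) :
    Forcing.IsDense (cohesiveSet X B) := by
  intro C
  obtain ⟨E, hE, hEC, hEinf, hcoh⟩ := hX.exists_isCohesive hB C.mem C.infinite
  have hle : (E \ C.carrier).Finite := by simp [Set.sdiff_eq_empty.2 hEC]
  exact ⟨⟨E, hE, hEinf⟩, hcoh, hle⟩

end Cohesive

section Ultrafilter

variable {X : Set (Set ℕ)} {S : ℕ → Set ℕ} {A B C E : Set ℕ} {k : ℕ}

namespace UltrafilterOn

variable (U : UltrafilterOn X)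

theorem imp_mem_iff {p q : ℕ → Prop} (hp : {k | p k} ∈ X) (hq : {k | q k} ∈ X)
    (hpq : {k | p k → q k} ∈ X) :
    {k | p k → q k} ∈ U.sets ↔ ({k | p k} ∈ U.sets → {k | q k} ∈ U.sets) := by
  refine ⟨fun h hpU => U.mem_of_superset _ (U.inter_mem _ h _ hpU) _ hq fun k hk => hk.1 hk.2,
    fun h => ?_⟩
  by_cases hpU : {k | p k} ∈ U.sets
  · exact U.mem_of_superset _ (h hpU) _ hpq fun k hk _ => hk
  · exact U.mem_of_superset _ ((U.mem_or_compl_mem _ hp).resolve_left hpU) _ hpq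
      fun k hk hpk => absurd hpk hk

theorem mem_iff_finite_sdiff (hU : U.Nonprincipal) (hE : E ∈ U.sets)
    (hA : A ∈ X) (hEA : (E \ A).Finite ∨ (E ∩ A).Finite) : A ∈ U.sets ↔ (E \ A).Finite := by
  refine ⟨fun h => hEA.resolve_right (hU _ (U.inter_mem E hE A h)), fun hfin => ?_⟩
  refine (U.mem_or_compl_mem A hA).resolve_right fun hc => hU _ (U.inter_mem E hE _ hc) ?_
  rwa [← Set.sdiff_eq]

theorem exists_singleton_mem (hX : ArithClosed X) (hU : ¬ U.Nonprincipal) :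
    ∃ k, {k} ∈ U.sets := by
  simp only [Nonprincipal, not_forall, Set.not_infinite] at hU
  obtain ⟨A, hAU, hAfin⟩ := hU
  induction A, hAfin using Set.Finite.induction_on with
  | empty => exact absurd hAU U.empty_notMem
  | @insert a A haA _ ih =>
    refine (U.mem_or_compl_mem {a} (hX.singleton_mem a)).elim (fun ha => ⟨a, ha⟩) fun ha => ih ?_
    simpa [← Set.sdiff_eq, haA] using U.inter_mem _ hAU _ ha

theorem mem_iff_of_singleton_mem (hk : {k} ∈ U.sets) (hA : A ∈ X) : A ∈ U.sets ↔ k ∈ A := by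
  refine ⟨fun h => by_contra fun hkA => U.empty_notMem ?_,
    fun h => U.mem_of_superset _ hk A hA (Set.singleton_subset_iff.2 h)⟩
  simpa only [Set.singleton_inter_eq_empty.2 hkA] using U.inter_mem _ hk A h

theorem forall_mem_sets_iff (hX : ArithClosed X) {R : ℕ → ℕ → Prop}
    (hR : (∅ : Set ℕ).Definable (arithLang X) {v : Fin 2 → ℕ | R (v 0) (v 1)}) :
    (∀ c : CodedFun X, {k | R k (c.1 k)} ∈ U.sets) ↔ {k | ∀ a, R k a} ∈ U.sets := by
  constructor
  · intro h
    obtain ⟨c, hc, hcR⟩ := hX.exists_isCoded_skolem (R := fun k a => ¬ R k a) (definable_not hR)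
    have hall : {k | ∀ a, R k a} ∈ X :=
      hX.mem_of_definable <| definable_forall <| definable_comp₂ hR (.proj _) (.proj _)
    exact U.mem_of_superset _ (h ⟨c, hc⟩) _ hall fun k hk a =>
      by_contra fun ha => hcR k ⟨a, ha⟩ hk
  · intro h c
    have hcX : {k | R k (c.1 k)} ∈ X :=
      hX.mem_of_definable <| definable_comp₂ hR (.proj _) (c.2.definableFun (.proj _))
    exact U.mem_of_superset _ h _ hcX fun k hk => hk _

end UltrafilterOn

theorem ArithClosed.setOf_finite_sdiff_slice_mem (hX : ArithClosed X) (hE : E ∈ X) (hB : B ∈ X) :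
    {n | (E \ slice B n).Finite} ∈ X := by
  have hbdd (n : ℕ) : (E \ slice B n).Finite ↔ ∃ N, ∀ m, m ∈ E ∧ m ∉ slice B n → ¬ N < m := by
    simp only [not_lt]
    exact Set.finite_iff_bddAbove
  simp only [hbdd]
  exact hX.mem_of_definable <| definable_exists <| definable_forall <| definable_imp
    (definable_and (definable_mem hE (.proj _))
      (definable_not (definable_mem_slice hB (.proj _) (.proj _))))
    (definable_not (definable_lt (.proj _) (.proj _)))

theorem ArithClosed.cohesiveSet_subset_decidingSet (hX : ArithClosed X) (hB : B ∈ X) :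
    cohesiveSet X B ⊆ decidingSet X B := by
  intro C hC U hCU
  by_cases hU : U.Nonprincipal
  · simpa only [U.mem_iff_finite_sdiff hU hCU (hX.slice_mem hB _) (hC _)] using
      hX.setOf_finite_sdiff_slice_mem C.mem hB
  · obtain ⟨k, hk⟩ := U.exists_singleton_mem hX hU
    simpa only [U.mem_iff_of_singleton_mem hk (hX.slice_mem hB _)] using
      hX.setOf_mem_slice_mem hB k

theorem ArithClosed.isDense_decidingSet (hX : ArithClosed X) (hB : B ∈ X) :
    Forcing.IsDense (decidingSet X B) := fun C =>
  let ⟨E, hE, hEC⟩ := hX.isDense_cohesiveSet hB C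
  ⟨E, hX.cohesiveSet_subset_decidingSet hB hE, hEC⟩

end Ultrafilter

section Los

variable {X : Set (Set ℕ)} {α : Type}

namespace ArithClosed

theorem isCoded_realize_term (hX : ArithClosed X)
    (t : (arithLang X).Term α) (f : α → CodedFun X) :
    IsCoded X fun k => t.realize fun i => (f i).1 k := by
  induction t with
  | var i => exact (f i).2
  | func F ts ih => exact hX.isCoded_funMap F _ ih

theorem setOf_boundedRealize_mem (hX : ArithClosed X) [Finite α] {n : ℕ}
    (φ : (arithLang X).BoundedFormula α n) (f : α → CodedFun X) (g : Fin n → CodedFun X) :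
    {k | φ.Realize (fun i => (f i).1 k) fun i => (g i).1 k} ∈ X :=
  hX.mem_of_definable <| definable_boundedRealize φ (fun i => (f i).2.definableFun (.proj _))
    fun i => (g i).2.definableFun (.proj _)

end ArithClosed

namespace Ultrapower

variable (hX : ArithClosed X) (G : UltrafilterOn X)

theorem mk_eq_mk {f g : CodedFun X} : mk hX G f = mk hX G g ↔ {k | f.1 k = g.1 k} ∈ G.sets :=
  Quotient.eq (r := ultraSetoid hX G)

theorem surjective_mk : Function.Surjective (mk hX G) :=
  Quotient.mk_surjective

theorem realize_term_mk (t : (arithLang X).Term α) (f : α → CodedFun X) :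
    t.realize (fun i => mk hX G (f i)) = mk hX G ⟨_, hX.isCoded_realize_term t f⟩ := by
  induction t with
  | var i => rfl
  | func F ts ih =>
    simp only [Term.realize_func, ih]
    exact funMap_quotient_mk' (ultraSetoid hX G) F
      fun i => (⟨_, hX.isCoded_realize_term (ts i) f⟩ : CodedFun X)

theorem realize_boundedFormula_mk [Finite α] {n : ℕ} (φ : (arithLang X).BoundedFormula α n)
    (f : α → CodedFun X) (g : Fin n → CodedFun X) :
    φ.Realize (fun i => mk hX G (f i)) (fun i => mk hX G (g i)) ↔
      {k | φ.Realize (fun i => (f i).1 k) fun i => (g i).1 k} ∈ G.sets := by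
  have hterm {n : ℕ} (t : (arithLang X).Term (α ⊕ Fin n)) (g : Fin n → CodedFun X) :
      t.realize (Sum.elim (fun i => mk hX G (f i)) fun i => mk hX G (g i)) =
        mk hX G ⟨_, hX.isCoded_realize_term t (Sum.elim f g)⟩ := by
    rw [← realize_term_mk]
    exact congrArg t.realize (Sum.comp_elim (mk hX G) f g).symm
  have hsum {n : ℕ} (g : Fin n → CodedFun X) (k : ℕ) :
      Sum.elim (fun i => (f i).1 k) (fun i => (g i).1 k) = fun i => (Sum.elim f g i).1 k :=
    (Sum.comp_elim (fun c : CodedFun X => c.1 k) f g).symm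
  induction φ with
  | falsum => simpa [BoundedFormula.Realize] using G.empty_notMem
  | equal t₁ t₂ =>
    simp only [BoundedFormula.Realize, hterm, hsum]
    exact mk_eq_mk hX G
  | rel r ts =>
    simp only [BoundedFormula.Realize, hterm, hsum]
    exact relMap_quotient_mk' (ultraSetoid hX G) r
      fun i => (⟨_, hX.isCoded_realize_term (ts i) (Sum.elim f g)⟩ : CodedFun X)
  | imp φ ψ ihφ ihψ =>
    simp only [BoundedFormula.realize_imp, ihφ, ihψ]
    exact (G.imp_mem_iff (hX.setOf_boundedRealize_mem φ f g)
      (hX.setOf_boundedRealize_mem ψ f g) (hX.setOf_boundedRealize_mem (φ.imp ψ) f g)).symm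
  | @all n ψ ih =>
    have hsnoc {Y : Type} (e : CodedFun X → Y) (c : CodedFun X) :
        (fun i => e ((Fin.snoc g c : Fin (n + 1) → CodedFun X) i)) =
          Fin.snoc (fun i => e (g i)) (e c) := Fin.comp_snoc e g c
    simp only [BoundedFormula.realize_all, (surjective_mk hX G).forall, ← hsnoc (mk hX G), ih]
    simp only [fun k : ℕ => hsnoc fun c => c.1 k]
    exact G.forall_mem_sets_iff hX
      (R := fun k a => ψ.Realize (fun i => (f i).1 k) (Fin.snoc (fun i => (g i).1 k) a)) <|
      definable_boundedRealize_snoc ψ (fun i => (f i).2.definableFun (.proj _))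
        (fun i => (g i).2.definableFun (.proj _)) (.proj _)

theorem realize_mk [Finite α] (φ : (arithLang X).Formula α) (f : α → CodedFun X) :
    φ.Realize (fun i => mk hX G (f i)) ↔ {k | φ.Realize fun i => (f i).1 k} ∈ G.sets := by
  simpa only [Formula.Realize, Unique.eq_default] using
    realize_boundedFormula_mk hX G φ f finZeroElim

/-- The canonical elementary embedding `n ↦ [c_n]_G` of the standard model. -/
def constEmbedding : ℕ ↪ₑ[arithLang X] Ultrapower hX G where
  toFun n := mk hX G ⟨fun _ => n, hX.isCoded_const n⟩
  map_formula' n φ x := by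
    refine (realize_mk hX G φ fun i => ⟨fun _ => x i, hX.isCoded_const (x i)⟩).trans ?_
    by_cases h : φ.Realize x
    · simpa [h] using G.univ_mem
    · simpa [h] using G.empty_notMem

theorem constEmbedding_apply (n : ℕ) :
    constEmbedding hX G n = mk hX G ⟨fun _ => n, hX.isCoded_const n⟩ :=
  rfl

theorem not_surjective_constEmbedding (hG : G.Nonprincipal) :
    ¬ Function.Surjective (constEmbedding hX G) := by
  intro h
  have hid : IsCoded X id :=
    hX.isCoded_of_definable_graph ((Set.DefinableFun.proj _).ofPred_eq (.proj _))
  obtain ⟨n, hn⟩ := h (mk hX G ⟨id, hid⟩)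
  have hsingleton : {k | n = k} ∈ G.sets := (mk_eq_mk hX G).1 hn
  exact hG _ hsingleton (by simp)

theorem exists_preimage_constEmbedding_eq {D : Set (Ultrapower hX G)}
    (hD : (Set.univ : Set (Ultrapower hX G)).Definable₁ (arithLang X) D) :
    ∃ B ∈ X, constEmbedding hX G ⁻¹' D = {n | slice B n ∈ G.sets} := by
  obtain ⟨A, -, hA⟩ := Set.definable_iff_finitely_definable.1 hD
  obtain ⟨φ, hφ⟩ := Set.definable_iff_exists_formula_sum.1 hA
  choose f hf using surjective_mk hX G
  let e (n : ℕ) : (A : Set (Ultrapower hX G)) ⊕ Fin 1 → CodedFun X :=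
    Sum.elim (fun a => f a) fun _ => ⟨fun _ => n, hX.isCoded_const n⟩
  have he (n : ℕ) : (fun i => mk hX G (e n i)) =
      Sum.elim Subtype.val fun _ => constEmbedding hX G n := by
    ext (a | _)
    · exact hf a
    · rfl
  obtain ⟨B, hB, hslice⟩ := hX.exists_slice_eq (R := fun n m => φ.Realize fun i => (e n i).1 m) <|
    definable_realize φ (t := fun i v => (e (v 0) i).1 (v 1)) <|
      Sum.forall.2 ⟨fun a => (f a).2.definableFun (.proj _), fun _ => .proj _⟩
  refine ⟨B, hB, Set.ext fun n => ?_⟩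
  calc
    constEmbedding hX G n ∈ D
      ↔ φ.Realize (Sum.elim Subtype.val fun _ => constEmbedding hX G n) :=
        Set.ext_iff.1 hφ fun _ => constEmbedding hX G n
    _ ↔ slice B n ∈ G.sets := by rw [← he, realize_mk, hslice]

theorem isConservative_constEmbedding (hG : G.Nonprincipal)
    (h : ∀ B ∈ X, {n | slice B n ∈ G.sets} ∈ X) : IsConservative (constEmbedding hX G) := by
  refine ⟨not_surjective_constEmbedding hX G hG, fun D hD => ?_⟩
  obtain ⟨B, hB, hpre⟩ := exists_preimage_constEmbedding_eq hX G hD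
  rw [hpre]
  exact definable_mem (h B hB) (.proj _)

end Ultrapower

end Los

section Generic

variable {X : Set (Set ℕ)} (hX : ArithClosed X) {F : Order.PFilter (ModFin X)}
  (hF : ∀ A ∈ X, ∃ C ∈ F, (C.carrier \ A).Finite ∨ (C.carrier ∩ A).Finite)

/-- The ultrafilter on `X` generated by a filter on `X/Fin` that splits every member of `X`: it
consists of the sets in `X` that almost include some condition of the filter. -/
def genericUltrafilter : UltrafilterOn X where
  sets := {A | A ∈ X ∧ ∃ C ∈ F, (C.carrier \ A).Finite}
  sub := fun A hA => hA.1
  univ_mem := by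
    obtain ⟨C, hC⟩ := F.nonempty
    exact ⟨hX.univ_mem, C, hC, by simp⟩
  empty_notMem := by
    rintro ⟨-, C, -, hC⟩
    exact C.infinite (by simpa using hC)
  inter_mem := by
    rintro A ⟨hA, C, hC, hCA⟩ B ⟨hB, D, hD, hDB⟩
    obtain ⟨E, hE, hEC, hED⟩ := F.directed C hC D hD
    have hEA : (E.carrier \ A).Finite :=
      (Set.Finite.union hEC hCA).subset (sdiff_triangle _ _ _)
    have hEB : (E.carrier \ B).Finite :=
      (Set.Finite.union hED hDB).subset (sdiff_triangle _ _ _)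
    exact ⟨hX.inter_mem hA hB, E, hE, by simpa only [Set.sdiff_inter] using hEA.union hEB⟩
  mem_of_superset := by
    rintro A ⟨-, C, hC, hCA⟩ B hB hAB
    exact ⟨hB, C, hC, hCA.subset (Set.sdiff_subset_sdiff_right hAB)⟩
  mem_or_compl_mem := by
    intro A hA
    obtain ⟨C, hC, h | h⟩ := hF A hA
    · exact Or.inl ⟨hA, C, hC, h⟩
    · exact Or.inr ⟨hX.compl_mem hA, C, hC, by rwa [Set.sdiff_compl]⟩

theorem nonprincipal_genericUltrafilter : (genericUltrafilter hX hF).Nonprincipal := by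
  rintro A ⟨-, C, -, hC⟩ hA
  exact C.infinite (hC.of_sdiff hA)

theorem mem_genericUltrafilter {C : ModFin X} (hC : C ∈ F) :
    C.carrier ∈ (genericUltrafilter hX hF).sets :=
  ⟨C.mem, C, hC, by simp⟩

end Generic

namespace ArithClosed

variable {X : Set (Set ℕ)}

theorem exists_forall_slice_eq (hX : ArithClosed X) {A : Set ℕ} (hA : A ∈ X) :
    ∃ B ∈ X, ∀ n, slice B n = A :=
  hX.exists_slice_eq (R := fun _ m => m ∈ A) (definable_mem hA (.proj _))

theorem exists_nonprincipal_ultrafilterOn (hX : ArithClosed X) (F : Order.PFilter (ModFin X))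
    (hF : ∀ B ∈ X, ∃ C ∈ F, C ∈ cohesiveSet X B) :
    ∃ G : UltrafilterOn X, G.Nonprincipal ∧ ∀ C ∈ F, C.carrier ∈ G.sets := by
  have hsplit : ∀ A ∈ X, ∃ C ∈ F, (C.carrier \ A).Finite ∨ (C.carrier ∩ A).Finite := by
    intro A hA
    obtain ⟨B, hB, hslice⟩ := hX.exists_forall_slice_eq hA
    obtain ⟨C, hC, hcoh⟩ := hF B hB
    exact ⟨C, hC, by simpa only [hslice] using hcoh 0⟩
  exact ⟨genericUltrafilter hX hsplit, nonprincipal_genericUltrafilter hX hsplit,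
    fun C hC => mem_genericUltrafilter hX hsplit hC⟩

theorem nonempty_modFin (hX : ArithClosed X) : Nonempty (ModFin X) :=
  ⟨⟨Set.univ, hX.univ_mem, Set.infinite_univ⟩⟩

end ArithClosed

end Scott

theorem theoremf_general (X : Set (Set ℕ)) (hX : Scott.ArithClosed X)
    (hfa : Forcing.ForcingAxiom (Scott.ModFin X) #X) :
    ∃ G : Scott.UltrafilterOn X, G.Nonprincipal ∧
      (∀ B ∈ X, Forcing.IsDense (Scott.decidingSet X B) ∧
        ∃ C ∈ Scott.decidingSet X B, C.carrier ∈ G.sets) ∧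
      ∃ j : ℕ ↪ₑ[Scott.arithLang X] Scott.Ultrapower hX G,
        (∀ n : ℕ, j n = Scott.Ultrapower.mk hX G ⟨fun _ => n, hX.isCoded_const n⟩) ∧
        Scott.IsConservative j := by
  obtain ⟨F, hF⟩ := hfa (Scott.cohesiveSet X '' X) mk_image_le
    (Set.forall_mem_image.2 fun B hB => hX.isDense_cohesiveSet hB)
  rw [Set.forall_mem_image] at hF
  obtain ⟨G, hG, hFG⟩ := hX.exists_nonprincipal_ultrafilterOn F fun B hB => hF hB
  have hdec : ∀ B ∈ X, ∃ C ∈ Scott.decidingSet X B, C.carrier ∈ G.sets := by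
    intro B hB
    obtain ⟨C, hC, hcoh⟩ := hF hB
    exact ⟨C, hX.cohesiveSet_subset_decidingSet hB hcoh, hFG C hC⟩
  refine ⟨G, hG, fun B hB => ⟨hX.isDense_decidingSet hB, hdec B hB⟩,
    Scott.Ultrapower.constEmbedding hX G, Scott.Ultrapower.constEmbedding_apply hX G,
    Scott.Ultrapower.isConservative_constEmbedding hX G hG fun B hB => ?_⟩
  obtain ⟨C, hC, hCG⟩ := hdec B hB
  exact hC G hCG

theorem theoremf (pfa : Forcing.ProperForcingAxiom.{0}) (X : Set (Set ℕ))
    (hX : Scott.IsProperScottSet X) (hcard : #X = ℵ₁) :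
    ∃ G : Scott.UltrafilterOn X, G.Nonprincipal ∧
      (∀ B ∈ X, Forcing.IsDense (Scott.decidingSet X B) ∧
        ∃ C ∈ Scott.decidingSet X B, C.carrier ∈ G.sets) ∧
      ∃ j : ℕ ↪ₑ[Scott.arithLang X] Scott.Ultrapower hX.arithClosed G,
        (∀ n : ℕ, j n = Scott.Ultrapower.mk hX.arithClosed G
          ⟨fun _ => n, hX.arithClosed.isCoded_const n⟩) ∧
        Scott.IsConservative j :=
  have := hX.arithClosed.nonempty_modFin
  theoremf_general X hX.arithClosed fun 𝒟 h𝒟 => pfa _ hX.isProper 𝒟 (h𝒟.trans hcard.le)
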